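/- Let $I$ be an index set containing two distinguished distinct elements $1,2$; for example $I=\{1,2,3,\dots\}$, or, after truncation, $I=\{1,\dots,N\}$ with $N\ge 2$. Let $W=W_{-1}\oplus W_0$ be the graded complex vector space for which $W_{-1}$ (degree $-1$, odd) has basis $\theta_1,\theta_2$ and $W_0$ (degree $0$, even) has basis $(x_i)_{i\in I}$. Let $B_0,B_1,B_2,\dots$ be complex numbers with $B_0=1$. Let $\Phi^n:W^{\otimes n}\to W$ $(n\ge 0)$ be the graded symmetric linear maps given on words in the basis elements by $$\Phi^1(\theta_\alpha)=B_0x_\alpha,\qquad \Phi^2(\theta_\alpha\otimes x_i)=B_1x_\alpha+x_i,\qquad \Phi^{M+1}(\theta_\alpha\otimes x_{i_1}\otimes\cdots\otimes x_{i_M})=B_Mx_\alpha\quad(M\ge 2),$$ for $\alpha\in\{1,2\}$ and $i,i_1,\dots,i_M\in I$, and by $\Phi^n=0$ on all words that contain no $\theta$ or at least two $\theta$'s. The hierarchy $\Phi^\bullet$ is called a homotopy Lie algebra ($L_\infty$ algebra) if the maps $\Phi^n$ are graded symmetric of degree $+1$ and satisfy the generalised Jacobi identities: for all $n\ge 0$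 and all homogeneous $z_1,\dots,z_n\in W$, $$\sum_{k=0}^n\ \sum_{\sigma}\varepsilon(\sigma;z)\,\Phi^{n-k+1}\bigl(\Phi^k(z_{\sigma(1)}\otimes\cdots\otimes z_{\sigma(k)})\otimes z_{\sigma(k+1)}\otimes\cdots\otimes z_{\sigma(n)}\bigr)=0,$$ where $\sigma$ runs over all $(k,n-k)$-unshuffles and $\varepsilon(\sigma;z)$ is the Koszul sign of the permutation of the homogeneous elements $z_1,\dots,z_n$. Then $\Phi^\bullet$ is a homotopy Lie algebra if and only if $$B_M=(1-M)^{M-1}\qquad\text{for all integers } M\ge 0,$$ with the convention $0^0=1$. -/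

import Mathlib

open scoped BigOperators

noncomputable section

/-- Koszul sign of the unshuffle `(z_a)_{a ∈ I}, (z_b)_{b ∉ I}` of a word `z_0, …, z_{n-1}` whose
letters have degrees `d`: one factor `(-1)^{d a * d b}` for each pair of letters that is
interchanged. -/
def koszulSign {n : ℕ} (d : Fin n → ℤ) (I : Finset (Fin n)) : ℤˣ :=
  ∏ a ∈ I, ∏ b ∈ Iᶜ with b < a, Int.negOnePow (d a * d b)

/-- The subword of `z` formed by the letters with position in `I`, in their original order. -/
def subword {W : Type*} {n : ℕ} (z : Fin n → W) (I : Finset (Fin n)) : Fin I.card → W :=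
  fun k => z (I.orderEmbOfFin rfl k)

/-- A hierarchy of brackets `Φ n : W^n → W`, one for each arity `n`, on a vector space `W`. -/
abbrev BracketHierarchy (𝕜 W : Type*) [Field 𝕜] [AddCommGroup W] [Module 𝕜 W] : Type _ :=
  ∀ n : ℕ, MultilinearMap 𝕜 (fun _ : Fin n => W) W

/-- A bracket hierarchy on a (desuspended) `ℤ`-graded vector space `W = ⨁ d, 𝒲 d` is a homotopy
Lie algebra (`L∞` algebra) if its brackets are of degree `+1`, are graded symmetric, and satisfy
the generalised Jacobi identities
`∑ ± Φ(Φ(z_{σ(1)}, …, z_{σ(k)}), z_{σ(k+1)}, …, z_{σ(n)}) = 0`,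
where the sum is over all `k` and all `(k, n-k)`-unshuffles `σ` and the sign is the Koszul sign.
An unshuffle is recorded by the set `I = {σ(1), …, σ(k)}`. -/
structure IsHomotopyLie {𝕜 W : Type*} [Field 𝕜] [AddCommGroup W] [Module 𝕜 W]
    (𝒲 : ℤ → Submodule 𝕜 W) [DirectSum.Decomposition 𝒲] (Φ : BracketHierarchy 𝕜 W) : Prop where
  degree : ∀ (n : ℕ) (d : Fin n → ℤ) (z : Fin n → W), (∀ i, z i ∈ 𝒲 (d i)) →
    Φ n z ∈ 𝒲 (1 + ∑ i, d i)
  symm : ∀ (n : ℕ) (d : Fin n → ℤ) (z : Fin n → W), (∀ i, z i ∈ 𝒲 (d i)) →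
    ∀ i j : Fin n, (j : ℕ) = i + 1 →
      Φ n z = Int.negOnePow (d i * d j) • Φ n (z ∘ Equiv.swap i j)
  jacobi : ∀ (n : ℕ) (d : Fin n → ℤ) (z : Fin n → W), (∀ i, z i ∈ 𝒲 (d i)) →
    ∑ I : Finset (Fin n), koszulSign d I •
      Φ (Iᶜ.card + 1) (Fin.cons (Φ I.card (subword z I)) (subword z Iᶜ)) = 0

/-! ### The space with two odd generators -/

/-- The vector space `W = W_{-1} ⊕ W_0`, where `W_{-1}` has a basis of two odd generators and
`W_0` has a basis of even generators indexed by `ι`. -/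
abbrev TwoFermionSpace (ι : Type*) : Type _ := (Fin 2 → ℂ) × (ι →₀ ℂ)

namespace TwoFermionSpace

variable {ι : Type*}

/-- The odd generators. -/
def θ (α : Fin 2) : TwoFermionSpace ι := (Pi.single α 1, 0)

/-- The even generators. -/
def x (i : ι) : TwoFermionSpace ι := (0, Finsupp.single i 1)

variable (ι) in
/-- The grading: the odd generators have degree `-1` and the even generators degree `0`. -/
def grading (d : ℤ) : Submodule ℂ (TwoFermionSpace ι) :=
  if d = -1 then Submodule.span ℂ (Set.range θ)
  else if d = 0 then Submodule.span ℂ (Set.range x)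
  else ⊥

theorem mem_grading_neg_one (v : Fin 2 → ℂ) : ((v, 0) : TwoFermionSpace ι) ∈ grading ι (-1) := by
  have h : ((v, 0) : TwoFermionSpace ι) = ∑ α, v α • θ α := by
    ext i
    · fin_cases i <;> simp [θ]
    · simp [θ]
  rw [h, grading, if_pos rfl]
  exact Submodule.sum_mem _ fun α _ => Submodule.smul_mem _ _ (Submodule.subset_span ⟨α, rfl⟩)

theorem mem_grading_zero (w : ι →₀ ℂ) : ((0, w) : TwoFermionSpace ι) ∈ grading ι 0 := by
  rw [grading, if_neg (by decide), if_pos rfl]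
  induction w using Finsupp.induction_linear with
  | zero => exact Submodule.zero_mem _
  | add f g hf hg => simpa using Submodule.add_mem _ hf hg
  | single i c =>
    have h : ((0, Finsupp.single i c) : TwoFermionSpace ι) = c • x i := by simp [x]
    rw [h]
    exact Submodule.smul_mem _ _ (Submodule.subset_span ⟨i, rfl⟩)

theorem snd_eq_zero_of_mem {z : TwoFermionSpace ι} (hz : z ∈ grading ι (-1)) : z.2 = 0 := by
  rw [grading, if_pos rfl] at hz
  induction hz using Submodule.span_induction with
  | mem z h => obtain ⟨α, rfl⟩ := h; rfl
  | zero => rfl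
  | add a b _ _ ha hb => simp [ha, hb]
  | smul c a _ ha => simp [ha]

theorem fst_eq_zero_of_mem {z : TwoFermionSpace ι} {d : ℤ} (hd : d ≠ -1)
    (hz : z ∈ grading ι d) : z.1 = 0 := by
  rw [grading, if_neg hd] at hz
  split_ifs at hz
  · induction hz using Submodule.span_induction with
    | mem z h => obtain ⟨α, rfl⟩ := h; rfl
    | zero => rfl
    | add a b _ _ ha hb => simp [ha, hb]
    | smul c a _ ha => simp [ha]
  · rw [Submodule.mem_bot] at hz
    rw [hz]; rfl

/-- The component of degree `-1`. -/
def oddComponent : TwoFermionSpace ι →ₗ[ℂ] grading ι (-1) :=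
  ((LinearMap.inl ℂ _ _).comp (LinearMap.fst ℂ _ _)).codRestrict (grading ι (-1))
    fun z => mem_grading_neg_one z.1

/-- The component of degree `0`. -/
def evenComponent : TwoFermionSpace ι →ₗ[ℂ] grading ι 0 :=
  ((LinearMap.inr ℂ _ _).comp (LinearMap.snd ℂ _ _)).codRestrict (grading ι 0)
    fun z => mem_grading_zero z.2

theorem coe_oddComponent (z : TwoFermionSpace ι) :
    (oddComponent z : TwoFermionSpace ι) = (z.1, 0) := rfl

theorem coe_evenComponent (z : TwoFermionSpace ι) :
    (evenComponent z : TwoFermionSpace ι) = (0, z.2) := rfl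

instance : DirectSum.Decomposition (grading ι) :=
  DirectSum.Decomposition.ofLinearMap (grading ι)
    ((DirectSum.lof ℂ ℤ (fun d => grading ι d) (-1)).comp oddComponent
      + (DirectSum.lof ℂ ℤ (fun d => grading ι d) 0).comp evenComponent)
    (by
      refine LinearMap.ext fun z => ?_
      simp only [LinearMap.comp_apply, LinearMap.add_apply, map_add,
        LinearMap.id_apply, DirectSum.coeLinearMap_lof, coe_oddComponent, coe_evenComponent]
      ext <;> simp)
    (by
      ext d ⟨z, hz⟩ : 2
      simp only [LinearMap.comp_apply, LinearMap.add_apply,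
          LinearMap.id_apply, DirectSum.coeLinearMap_lof]
      by_cases h1 : d = -1
      · subst h1
        have h3 : z.2 = 0 := snd_eq_zero_of_mem hz
        have e1 : oddComponent z = ⟨z, hz⟩ := Subtype.ext (Prod.ext rfl h3.symm)
        have e2 : evenComponent z = 0 := Subtype.ext (Prod.ext rfl h3)
        rw [e1, e2, map_zero, add_zero]
      · have h3 : z.1 = 0 := fst_eq_zero_of_mem h1 hz
        have e1 : oddComponent z = 0 := Subtype.ext (Prod.ext h3 rfl)
        rw [e1, map_zero, zero_add]
        by_cases h0 : d = 0
        · subst h0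
          have e2 : evenComponent z = ⟨z, hz⟩ := Subtype.ext (Prod.ext h3.symm rfl)
          rw [e2]
        · have hz' : z = 0 := by
            rw [grading, if_neg h1, if_neg h0, Submodule.mem_bot] at hz
            exact hz
          subst hz'
          rw [map_zero, map_zero]
          exact (map_zero _).symm)

/-- Coefficient of `θ α`. -/
def θCoeff (α : Fin 2) : TwoFermionSpace ι →ₗ[ℂ] ℂ :=
  (LinearMap.proj α).comp (LinearMap.fst ℂ _ _)

/-- Sum of the coefficients of the even generators: every `x i` is sent to `1`, every `θ α`
to `0`. -/
def xSum : TwoFermionSpace ι →ₗ[ℂ] ℂ :=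
  (Finsupp.linearCombination ℂ fun _ => (1 : ℂ)).comp (LinearMap.snd ℂ _ _)

/-- The projection onto the even part. -/
def evenPart : TwoFermionSpace ι →ₗ[ℂ] TwoFermionSpace ι :=
  (LinearMap.inr ℂ _ _).comp (LinearMap.snd ℂ _ _)

/-- The graded symmetric multilinear map of arity `n` that sends
`θ α ⊗ x i₁ ⊗ ⋯ ⊗ x iₙ₋₁` to `y α`, and vanishes on words in the generators
with no `θ` or with more than one `θ`. -/
def mainPart (y : Fin 2 → TwoFermionSpace ι) (n : ℕ) :
    MultilinearMap ℂ (fun _ : Fin n => TwoFermionSpace ι) (TwoFermionSpace ι) :=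
  ∑ k : Fin n, ∑ α : Fin 2,
    ((MultilinearMap.mkPiAlgebra ℂ (Fin n) ℂ).compLinearMap
      fun j => if j = k then θCoeff α else xSum).smulRight (y α)

/-- The graded symmetric bilinear map that sends `θ α ⊗ x i` to `x i`, and vanishes on words
in the generators with no `θ` or with two of them. -/
def extraPart : MultilinearMap ℂ (fun _ : Fin 2 => TwoFermionSpace ι) (TwoFermionSpace ι) where
  toFun z := (∑ α, θCoeff α (z 0)) • evenPart (z 1) + (∑ α, θCoeff α (z 1)) • evenPart (z 0)
  map_update_add' := by
    intro inst z i a b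
    rw [Subsingleton.elim inst (instDecidableEqFin 2)]
    fin_cases i <;> simp [Function.update] <;> module
  map_update_smul' := by
    intro inst z i c a
    rw [Subsingleton.elim inst (instDecidableEqFin 2)]
    fin_cases i <;> simp [Function.update] <;> module

/-- The bracket hierarchy
`Φ¹(θ_α) = B₀ x_α`, `Φ²(θ_α ⊗ x_i) = B₁ x_α + x_i`, `Φⁿ⁺¹(θ_α ⊗ x_{i₁} ⊗ ⋯ ⊗ x_{iₙ}) = Bₙ x_α`
for `n ≥ 2`, all other sectors being zero. Here `x_α`, for `α = 1, 2`, are the two even generators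
with the distinct indices `ν α`. -/
def bracket (ν : Fin 2 ↪ ι) (B : ℕ → ℂ) : BracketHierarchy ℂ (TwoFermionSpace ι)
  | 0 => 0
  | 1 => mainPart (fun α => B 0 • x (ν α)) 1
  | 2 => mainPart (fun α => B 1 • x (ν α)) 2 + extraPart
  | n + 3 => mainPart (fun α => B (n + 2) • x (ν α)) (n + 3)

/-- The value of the brackets on words in the generators with a single `θ`. -/
theorem bracket_θ_x (ν : Fin 2 ↪ ι) (B : ℕ → ℂ) (n : ℕ) (α : Fin 2) (i : Fin n → ι) :
    bracket ν B (n + 1) (Fin.cons (θ α) fun k => x (i k)) =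
      B n • x (ν α) + if n = 1 then ∑ k, x (i k) else 0 := by
  have main : ∀ y : Fin 2 → TwoFermionSpace ι,
      mainPart y (n + 1) (Fin.cons (θ α) fun k => x (i k)) = y α := by
    intro y
    rw [mainPart, sum_apply, Finset.sum_eq_single 0, sum_apply, Finset.sum_eq_single α]
    · simp [Fin.prod_univ_succ, θCoeff, xSum, θ, x]
    · intro β _ hβ
      simp [Fin.prod_univ_succ, θCoeff, θ, hβ]
    · simp
    · intro k _ hk
      rw [sum_apply]
      refine Finset.sum_eq_zero fun β _ => ?_
      simp [Fin.prod_univ_succ, xSum, θ, hk.symm]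
    · simp
  match n, i, main with
  | 0, i, main => simp [bracket, main]
  | 1, i, main =>
    have extra : extraPart (Fin.cons (θ α) fun k => x (i k)) = x (i 0) := by
      simp only [extraPart, MultilinearMap.coe_mk, Fin.cons_zero, Fin.cons_one]
      fin_cases α <;> simp [θCoeff, evenPart, θ, x]
    rw [bracket, add_apply, main, extra]
    simp
  | n + 2, i, main => simp [bracket, main]

/-- The brackets vanish on words in the generators with no `θ`. -/
theorem bracket_x (ν : Fin 2 ↪ ι) (B : ℕ → ℂ) (n : ℕ) (i : Fin n → ι) :
    bracket ν B n (fun k => x (i k)) = 0 := by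
  have main : ∀ y : Fin 2 → TwoFermionSpace ι, mainPart y n (fun k => x (i k)) = 0 := by
    intro y
    rw [mainPart, sum_apply]
    refine Finset.sum_eq_zero fun k _ => ?_
    rw [sum_apply]
    refine Finset.sum_eq_zero fun α _ => ?_
    have h : ∏ j, (if j = k then θCoeff α else xSum) (x (i j)) = 0 :=
      Finset.prod_eq_zero (Finset.mem_univ k) (by simp [θCoeff, x])
    simp [h]
  match n, i, main with
  | 0, i, main => simp [bracket]
  | 1, i, main => simp [bracket, main]
  | 2, i, main =>
    have extra : extraPart (fun k => x (i k)) = 0 := by simp [extraPart, θCoeff, x]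
    rw [bracket, add_apply, main, extra, add_zero]
  | n + 3, i, main => simp [bracket, main]

/-- The brackets vanish on words that contain two or more `θ`s. -/
theorem bracket_θ_θ (ν : Fin 2 ↪ ι) (B : ℕ → ℂ) (n : ℕ) (z : Fin n → TwoFermionSpace ι)
    (k l : Fin n) (hkl : k ≠ l) (α β : Fin 2) (hk : z k = θ α) (hl : z l = θ β) :
    bracket ν B n z = 0 := by
  have main : ∀ y : Fin 2 → TwoFermionSpace ι, mainPart y n z = 0 := by
    intro y
    rw [mainPart, sum_apply]
    refine Finset.sum_eq_zero fun p _ => ?_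
    rw [sum_apply]
    refine Finset.sum_eq_zero fun γ _ => ?_
    have h : ∏ j, (if j = p then θCoeff γ else xSum) (z j) = 0 := by
      by_cases hp : k = p
      · exact Finset.prod_eq_zero (Finset.mem_univ l)
          (by rw [if_neg (hp ▸ hkl.symm), hl]; simp [xSum, θ])
      · exact Finset.prod_eq_zero (Finset.mem_univ k) (by rw [if_neg hp, hk]; simp [xSum, θ])
    simp [h]
  match n, z, k, l, hkl, hk, hl, main with
  | 1, z, k, l, hkl, hk, hl, main => exact absurd (Subsingleton.elim k l) hkl
  | 2, z, k, l, hkl, hk, hl, main =>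
    have h0 : evenPart (z 0) = 0 := by
      fin_cases k <;> fin_cases l <;> simp_all [evenPart, θ]
    have h1 : evenPart (z 1) = 0 := by
      fin_cases k <;> fin_cases l <;> simp_all [evenPart, θ]
    simp [bracket, main, extraPart, h0, h1]
  | n + 3, z, k, l, hkl, hk, hl, main => simp [bracket, main]

end TwoFermionSpace

end

/-! ### The recursion for the coefficients and Abel's identity. -/

noncomputable section

/-! A bracket is nonzero only when exactly one letter is odd, and its value is then even. A nested
pair of brackets therefore needs exactly two odd letters, one in each bracket, and the Jacobi
identities are trivial on all other words.

For odd letters `z p`, `z q` and `N` even ones, the terms with `z p` inside and those with `z q`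
inside enter with opposite Koszul signs. The main parts give `∑ k, N.choose k * B k * B (N - k +
1)`. The extra binary bracket adds `N * B N` when it is the inner bracket and, after
antisymmetrisation, `-B N` when it is the outer one. The Jacobi identities thus amount to the
recursion `∑ k, N.choose k * B k * B (N - k + 1) = (1 - N) * B N` (`jacobi_sum`,
`recursion_of_jacobi`).

As `B 0 = 1`, the recursion determines `B (N + 1)` from the earlier values, so there is only one
solution. That `(1 - M) ^ (M - 1)` is this solution is a case of Abel's binomial identity
(`sum_choose_mul_zpow_mul_add_pow`). -/

theorem sum_choose_mul_zpow_mul_sub_one_pow (n : ℕ) :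
    ∑ k ∈ Finset.range (n + 2), ((n + 1).choose k : ℂ) * (1 - (k : ℂ)) ^ ((k : ℤ) - 1) *
      ((k : ℂ) - 1) ^ (n + 1 - k) = 0 := by
  -- Up to the sign `(-1) ^ (n + 1 - k)`, the two powers combine to `(1 - k) ^ n`. The sum is
  -- therefore the `(n + 1)`-st forward difference at `0` of a polynomial of degree at most `n`.
  have hdeg : ((1 - Polynomial.X : Polynomial ℂ) ^ n).natDegree < n + 1 := by
    refine Nat.lt_succ_of_le ((Polynomial.natDegree_pow_le_of_le n (m := 1) ?_).trans (by simp))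
    compute_degree
  have h := congrFun (Polynomial.fwdDiff_iter_eq_zero_of_degree_lt hdeg) 0
  rw [fwdDiff_iter_eq_sum_shift] at h
  simp only [Pi.zero_apply] at h
  rw [← h]
  refine Finset.sum_congr rfl fun k hk => ?_
  have hk : k ≤ n + 1 := Nat.lt_succ_iff.mp (Finset.mem_range.mp hk)
  have h1 : (1 - (k : ℂ)) ^ ((k : ℤ) - 1) * (1 - (k : ℂ)) ^ (n + 1 - k) = (1 - (k : ℂ)) ^ n := by
    rcases eq_or_ne k 1 with rfl | hk1
    · simp
    · have : (1 - (k : ℂ)) ≠ 0 := by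
        rw [sub_ne_zero]; exact_mod_cast hk1.symm
      rw [← zpow_natCast, ← zpow_natCast, ← zpow_add₀ this]
      congr 1
      push_cast [Nat.cast_sub hk]
      ring
  have h2 : ((k : ℂ) - 1) ^ (n + 1 - k) = (-1) ^ (n + 1 - k) * (1 - (k : ℂ)) ^ (n + 1 - k) := by
    rw [← mul_pow]; ring
  rw [h2, zsmul_eq_mul]
  simp only [zero_add, nsmul_eq_mul, mul_one, Polynomial.eval_pow, Polynomial.eval_sub,
    Polynomial.eval_one, Polynomial.eval_X]
  rw [← h1]
  push_cast
  ring

open Polynomial in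
/-- A case of Abel's binomial identity. -/
theorem sum_choose_mul_zpow_mul_add_pow (n : ℕ) :
    ∑ k ∈ Finset.range (n + 1), C ((n.choose k : ℂ) * (1 - (k : ℂ)) ^ ((k : ℤ) - 1)) *
      (X + C (k : ℂ)) ^ (n - k) = (X + 1) ^ n := by
  induction n with
  | zero => simp
  | succ n ih =>
    rw [← sub_eq_zero]
    -- Differentiating gives `n + 1` times the identity for `n`, so the two sides differ by a
    -- constant.
    have hd : derivative (∑ k ∈ Finset.range (n + 1 + 1),
        C (((n + 1).choose k : ℂ) * (1 - (k : ℂ)) ^ ((k : ℤ) - 1)) *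
        (X + C (k : ℂ)) ^ (n + 1 - k) - (X + 1) ^ (n + 1)) = 0 := by
      rw [derivative_sub, sub_eq_zero, derivative_sum, Finset.sum_range_succ]
      have h1 : derivative ((X + 1 : ℂ[X]) ^ (n + 1)) = C ((n : ℂ) + 1) * (X + 1) ^ n := by
        simp [derivative_pow]
      rw [h1, ← ih, Finset.mul_sum]
      simp only [Nat.sub_self, pow_zero, mul_one, derivative_C, add_zero]
      refine Finset.sum_congr rfl fun k hk => ?_
      have hk : k ≤ n := Nat.lt_succ_iff.mp (Finset.mem_range.mp hk)
      have h2 : ((n + 1).choose k : ℂ) * ((n - k : ℕ) + 1) = (n + 1) * n.choose k := by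
        have h3 := Nat.choose_mul_succ_eq n k
        rw [Nat.succ_sub hk] at h3
        have h4 : (n.choose k : ℂ) * (n + 1) = (n + 1).choose k * ((n - k : ℕ) + 1) := by
          exact_mod_cast h3
        rw [← h4, mul_comm]
      rw [Nat.succ_sub hk, derivative_C_mul, derivative_pow]
      simp only [derivative_add, derivative_X, derivative_C, add_zero, mul_one, Nat.succ_sub_one]
      rw [← mul_assoc, ← mul_assoc, ← C_mul, ← C_mul]
      congr 2
      push_cast
      linear_combination (1 - (k : ℂ)) ^ ((k : ℤ) - 1) * h2
    rw [eq_C_of_derivative_eq_zero hd]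
    -- The constant is read off at `-1`, where `(X + 1) ^ (n + 1)` vanishes and the sum is a forward
    -- difference.
    have he := congrArg (eval (-1)) (eq_C_of_derivative_eq_zero hd)
    rw [eval_C] at he
    rw [← he, C_eq_zero, eval_sub, eval_finsetSum]
    have := sum_choose_mul_zpow_mul_sub_one_pow n
    simpa [neg_add_eq_sub] using this

/-- Abel's identity at `X = -n`: there `(X + k) ^ (n - k)` becomes `B (n - k + 1)`, and the
right-hand side becomes `(1 - n) ^ n`. -/
theorem sum_choose_mul_recursion (B : ℕ → ℂ) (hB : ∀ M : ℕ, B M = (1 - (M : ℂ)) ^ ((M : ℤ) - 1))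
    (n : ℕ) : ∑ k ∈ Finset.range (n + 1), (n.choose k : ℂ) * (B k * B (n - k + 1)) =
      (1 - n) * B n := by
  have h := congrArg (Polynomial.eval (-(n : ℂ))) (sum_choose_mul_zpow_mul_add_pow n)
  rw [Polynomial.eval_finsetSum] at h
  have h2 : (1 - (n : ℂ)) * B n = (1 - (n : ℂ)) ^ n := by
    rw [hB n]
    rcases eq_or_ne n 1 with rfl | hn
    · simp
    · have : (1 - (n : ℂ)) ≠ 0 := by
        rw [sub_ne_zero]; exact_mod_cast hn.symm
      rw [zpow_sub_one₀ this, zpow_natCast]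
      field_simp
  rw [h2]
  simp only [Polynomial.eval_mul, Polynomial.eval_C, Polynomial.eval_pow, Polynomial.eval_add,
    Polynomial.eval_X, Polynomial.eval_one] at h
  rw [show (1 - (n : ℂ)) = -n + 1 by ring, ← h]
  refine Finset.sum_congr rfl fun k hk => ?_
  have hk : k ≤ n := Nat.lt_succ_iff.mp (Finset.mem_range.mp hk)
  rw [mul_assoc, hB k, hB (n - k + 1)]
  congr 2
  rw [show ((n - k + 1 : ℕ) : ℤ) - 1 = ((n - k : ℕ) : ℤ) by push_cast; ring, zpow_natCast]
  congr 1
  push_cast [Nat.cast_sub hk]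
  ring

/-- The recursion `∑ k, n.choose k * B k * B (n - k + 1) = (1 - n) * B n` characterises the
sequence `(1 - n) ^ (n - 1)`. -/
theorem recursion_iff (B : ℕ → ℂ) (h0 : B 0 = 1) :
    (∀ n : ℕ, ∑ k ∈ Finset.range (n + 1), (n.choose k : ℂ) * (B k * B (n - k + 1)) =
      (1 - n) * B n) ↔ ∀ M : ℕ, B M = (1 - (M : ℂ)) ^ ((M : ℤ) - 1) := by
  refine ⟨fun h M => ?_, fun h n => sum_choose_mul_recursion B h n⟩
  set A : ℕ → ℂ := fun M => (1 - (M : ℂ)) ^ ((M : ℤ) - 1) with hA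
  have hA' := sum_choose_mul_recursion A (fun _ => rfl)
  have hA0 : A 0 = 1 := by simp [hA]
  change B M = A M
  induction M using Nat.strong_induction_on with
  | _ M ih =>
    rcases M with _ | n
    · rw [h0, hA0]
    · have h1 := h n
      have h2 := hA' n
      -- The term `k = 0` is `B 0 * B (n + 1)`; all other terms involve only indices up to `n`.
      rw [Finset.sum_range_succ'] at h1 h2
      have h3 : ∑ k ∈ Finset.range n, (n.choose (k + 1) : ℂ) * (B (k + 1) * B (n - (k + 1) + 1)) =
          ∑ k ∈ Finset.range n, (n.choose (k + 1) : ℂ) * (A (k + 1) * A (n - (k + 1) + 1)) := by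
        refine Finset.sum_congr rfl fun k hk => ?_
        have := Finset.mem_range.mp hk
        rw [ih (k + 1) (by omega), ih (n - (k + 1) + 1) (by omega)]
      rw [h3, ih n (by omega), ← h2, h0, hA0] at h1
      simpa using h1

/-! ### Brackets indexed by sets of positions. -/

namespace TwoFermionSpace

variable {ι σ : Type*} [DecidableEq σ]

/-- The sum of the coefficients of the odd generators. -/
def θSum : TwoFermionSpace ι →ₗ[ℂ] ℂ := ∑ α, θCoeff α

/-- The linear map that sends `θ α` to the distinguished even generator `x (ν α)`. -/
def θToX (ν : Fin 2 ↪ ι) : TwoFermionSpace ι →ₗ[ℂ] TwoFermionSpace ι :=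
  ∑ α, (θCoeff α).smulRight (x (ν α))

/-- The bracket of the letters of `z` with position in a finite set. -/
def setBracket (ν : Fin 2 ↪ ι) (B : ℕ → ℂ) (z : σ → TwoFermionSpace ι) (J : Finset σ) :
    TwoFermionSpace ι :=
  ∑ k ∈ J, (B (J.card - 1) * ∏ j ∈ J.erase k, xSum (z j)) • θToX ν (z k) +
    if J.card = 2 then ∑ k ∈ J, θSum (z k) • ∑ j ∈ J.erase k, evenPart (z j) else 0

theorem mainPart_apply (ν : Fin 2 ↪ ι) (b : ℂ) (n : ℕ) (z : Fin n → TwoFermionSpace ι) :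
    mainPart (fun α => b • x (ν α)) n z =
      ∑ k, (b * ∏ j ∈ Finset.univ.erase k, xSum (z j)) • θToX ν (z k) := by
  rw [mainPart, sum_apply]
  refine Finset.sum_congr rfl fun k _ => ?_
  rw [sum_apply, θToX, LinearMap.sum_apply, Finset.smul_sum]
  refine Finset.sum_congr rfl fun α _ => ?_
  have h : ∏ j, (if j = k then θCoeff α else xSum) (z j) =
      θCoeff α (z k) * ∏ j ∈ Finset.univ.erase k, xSum (z j) := by
    rw [← Finset.mul_prod_erase _ _ (Finset.mem_univ k), if_pos rfl]
    congr 1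
    exact Finset.prod_congr rfl fun j hj => by rw [if_neg (Finset.ne_of_mem_erase hj)]
  simp only [MultilinearMap.smulRight_apply, MultilinearMap.compLinearMap_apply,
    MultilinearMap.mkPiAlgebra_apply, h, LinearMap.smulRight_apply, smul_smul]
  congr 1
  ring

/-- The right-hand side does not depend on the order of the letters, so unshuffles can be handled as
subsets. The truncated `J.card - 1` is harmless, since the sum is empty for `J = ∅`. -/
theorem bracket_apply (ν : Fin 2 ↪ ι) (B : ℕ → ℂ) (n : ℕ) (z : Fin n → TwoFermionSpace ι) :
    bracket ν B n z = setBracket ν B z Finset.univ := by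
  match n, z with
  | 0, z => simp [bracket, setBracket]
  | 1, z => simp [bracket, setBracket, mainPart_apply]
  | 2, z =>
    have h0 : (Finset.univ.erase (0 : Fin 2)) = {1} := by decide
    have h1 : (Finset.univ.erase (1 : Fin 2)) = {0} := by decide
    simp [bracket, setBracket, mainPart_apply, extraPart, θSum, h0, h1]
  | n + 3, z => simp [bracket, setBracket, mainPart_apply]

theorem setBracket_map {τ : Type*} [DecidableEq τ] (ν : Fin 2 ↪ ι) (B : ℕ → ℂ)
    (z : σ → TwoFermionSpace ι) (f : τ ↪ σ) (J : Finset τ) :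
    setBracket ν B z (J.map f) = setBracket ν B (z ∘ f) J := by
  simp only [setBracket, Finset.sum_map, Finset.card_map, ← Finset.map_erase, Finset.prod_map,
    Function.comp_apply]

theorem bracket_comp (ν : Fin 2 ↪ ι) (B : ℕ → ℂ) {n : ℕ} (z : σ → TwoFermionSpace ι)
    (f : Fin n ↪ σ) : bracket ν B n (z ∘ f) = setBracket ν B z (Finset.univ.map f) := by
  rw [bracket_apply, setBracket_map]

theorem bracket_subword (ν : Fin 2 ↪ ι) (B : ℕ → ℂ) {n : ℕ} (z : Fin n → TwoFermionSpace ι)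
    (I : Finset (Fin n)) : bracket ν B I.card (subword z I) = setBracket ν B z I := by
  have h := bracket_comp ν B z (I.orderEmbOfFin rfl).toEmbedding
  rw [Finset.map_orderEmbOfFin_univ] at h
  exact h

/-- The extra position `none` carries the value of the inner bracket. -/
theorem bracket_cons_subword (ν : Fin 2 ↪ ι) (B : ℕ → ℂ) {n : ℕ} (v : TwoFermionSpace ι)
    (z : Fin n → TwoFermionSpace ι) (I : Finset (Fin n)) :
    bracket ν B (I.card + 1) (Fin.cons v (subword z I)) =
      setBracket ν B (fun o : Option (Fin n) => o.elim v z) I.insertNone := by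
  let f : Fin (I.card + 1) → Option (Fin n) :=
    Fin.cons none fun k => some (I.orderEmbOfFin rfl k)
  have hf : Function.Injective f := by
    rw [Fin.cons_injective_iff]
    exact ⟨by simp, (Option.some_injective _).comp (I.orderEmbOfFin rfl).injective⟩
  have h := bracket_comp ν B (fun o : Option (Fin n) => o.elim v z) ⟨f, hf⟩
  have h1 : Finset.univ.map ⟨f, hf⟩ = I.insertNone := by
    ext o
    rcases o with _ | i
    · simpa using ⟨0, rfl⟩
    · have h2 := congrArg (i ∈ ·) (Finset.map_orderEmbOfFin_univ I rfl)
      simp only [Finset.mem_map, Finset.mem_univ, true_and] at h2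
      simpa [Fin.exists_fin_succ, f] using h2
  rw [← h1, ← h]
  congr 1
  funext k
  refine Fin.cases rfl (fun k => rfl) k

theorem setBracket_fst (ν : Fin 2 ↪ ι) (B : ℕ → ℂ) (z : σ → TwoFermionSpace ι) (J : Finset σ) :
    (setBracket ν B z J).1 = 0 := by
  have h1 : ∀ v : TwoFermionSpace ι, (θToX ν v).1 = 0 := fun v => by simp [θToX, x]
  have h2 : ∀ v : TwoFermionSpace ι, (evenPart v).1 = 0 := fun v => by simp [evenPart]
  rw [setBracket]
  split_ifs <;> simp [Prod.fst_sum, h1, h2]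

section Components

variable {v : TwoFermionSpace ι}

theorem θSum_eq_zero (h : v.1 = 0) : θSum v = 0 := by simp [θSum, θCoeff, h]

theorem θToX_eq_zero (ν : Fin 2 ↪ ι) (h : v.1 = 0) : θToX ν v = 0 := by simp [θToX, θCoeff, h]

theorem xSum_eq_zero (h : v.2 = 0) : xSum v = 0 := by simp [xSum, h]

theorem evenPart_eq_zero (h : v.2 = 0) : evenPart v = 0 := by simp [evenPart, h]

theorem evenPart_eq_self (h : v.1 = 0) : evenPart v = v := by
  refine Prod.ext ?_ ?_ <;> simp [evenPart, h]

theorem xSum_evenPart : xSum (evenPart v) = xSum v := by simp [xSum, evenPart]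

theorem xSum_θToX (ν : Fin 2 ↪ ι) : xSum (θToX ν v) = θSum v := by
  simp [xSum, θToX, θSum, x]

end Components

theorem setBracket_eq_single (ν : Fin 2 ↪ ι) (B : ℕ → ℂ) (z : σ → TwoFermionSpace ι)
    {p : σ} {S : Finset σ} (hp : p ∉ S) (hS : ∀ j ∈ S, (z j).1 = 0) :
    setBracket ν B z (insert p S) = (B S.card * ∏ j ∈ S, xSum (z j)) • θToX ν (z p) +
      if S.card = 1 then θSum (z p) • ∑ j ∈ S, evenPart (z j) else 0 := by
  rw [setBracket, Finset.card_insert_of_notMem hp, Finset.sum_insert hp, Finset.sum_insert hp,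
    Finset.erase_insert hp, Finset.sum_eq_zero fun k hk => by rw [θToX_eq_zero ν (hS k hk),
      smul_zero], Finset.sum_eq_zero (f := fun k => θSum (z k) • _) fun k hk => by
      rw [θSum_eq_zero (hS k hk), zero_smul]]
  simp

/-- Without an odd letter, `θToX` and `θSum` vanish throughout. With two or more, each product over
`J.erase k` has an odd factor, and in the binary term both letters are odd. -/
theorem setBracket_eq_zero (ν : Fin 2 ↪ ι) (B : ℕ → ℂ) {z : σ → TwoFermionSpace ι}
    {T J : Finset σ} (hodd : ∀ i ∈ T, (z i).2 = 0) (heven : ∀ i ∉ T, (z i).1 = 0)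
    (hJ : (J ∩ T).card ≠ 1) : setBracket ν B z J = 0 := by
  by_cases h0 : (J ∩ T).card = 0
  · have h : ∀ j ∈ J, (z j).1 = 0 := fun j hj => heven j fun hT => by
      rw [Finset.card_eq_zero] at h0
      exact Finset.notMem_empty j (h0 ▸ Finset.mem_inter.mpr ⟨hj, hT⟩)
    rw [setBracket, Finset.sum_eq_zero fun k hk => by rw [θToX_eq_zero ν (h k hk), smul_zero],
      Finset.sum_eq_zero (s := J) fun k hk => by rw [θSum_eq_zero (h k hk), zero_smul]]
    simp
  · have h2 : 1 < (J ∩ T).card := by omega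
    have h : ∀ k, ∏ j ∈ J.erase k, xSum (z j) = 0 := fun k => by
      obtain ⟨j, hj, hjk⟩ := Finset.exists_mem_ne h2 k
      rw [Finset.mem_inter] at hj
      exact Finset.prod_eq_zero (Finset.mem_erase.mpr ⟨hjk, hj.1⟩) (xSum_eq_zero (hodd j hj.2))
    have h3 : J.card = 2 → ∀ j ∈ J, evenPart (z j) = 0 := fun hc j hj => by
      have : J ∩ T = J := Finset.eq_of_subset_of_card_le Finset.inter_subset_left (by omega)
      exact evenPart_eq_zero (hodd j (Finset.mem_inter.mp (this ▸ hj)).2)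
    rw [setBracket, Finset.sum_eq_zero fun k _ => by rw [h k, mul_zero, zero_smul], zero_add]
    split_ifs with hc
    · refine Finset.sum_eq_zero fun k _ => ?_
      rw [Finset.sum_eq_zero fun j hj => h3 hc j (Finset.mem_of_mem_erase hj), smul_zero]
    · rfl

/-- The main part of an outer bracket sees an even inner value only through `xSum`; there the extra
binary bracket just replaces `B 1` by `B 1 + 1`. -/
theorem xSum_setBracket (ν : Fin 2 ↪ ι) (B : ℕ → ℂ) (z : σ → TwoFermionSpace ι)
    {p : σ} {S : Finset σ} (hp : p ∉ S) (hS : ∀ j ∈ S, (z j).1 = 0) :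
    xSum (setBracket ν B z (insert p S)) =
      (B S.card + if S.card = 1 then 1 else 0) * (∏ j ∈ S, xSum (z j)) * θSum (z p) := by
  rw [setBracket_eq_single ν B z hp hS, map_add, map_smul, xSum_θToX]
  split_ifs with h
  · obtain ⟨j, rfl⟩ := Finset.card_eq_one.mp h
    simp [xSum_evenPart]
    ring
  · simp

/-- The bracket of a bracket with one odd letter `z p` and further letters, of which one, `z q`,
is odd. -/
theorem setBracket_insertNone (ν : Fin 2 ↪ ι) (B : ℕ → ℂ) (z : σ → TwoFermionSpace ι)
    {v : TwoFermionSpace ι} (hv : v.1 = 0) {q : σ} {S : Finset σ} (hq : q ∉ S)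
    (hS : ∀ j ∈ S, (z j).1 = 0) :
    setBracket ν B (fun o : Option σ => o.elim v z) (insert q S).insertNone =
      (B (S.card + 1) * (xSum v * ∏ j ∈ S, xSum (z j))) • θToX ν (z q) +
      if S = ∅ then θSum (z q) • v else 0 := by
  have h : (insert q S).insertNone = insert (some q) S.insertNone := by
    ext o
    rcases o with _ | i <;> simp
  have h1 : ∀ o ∈ S.insertNone, (o.elim v z).1 = 0 := by
    rintro (_ | i) hi
    · exact hv
    · exact hS i (by simpa using hi)
  rw [h, setBracket_eq_single _ _ _ (by simpa using hq) h1, Finset.card_insertNone,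
    Finset.prod_insertNone, Finset.sum_insertNone]
  congr 1
  by_cases hS0 : S = ∅
  · subst hS0
    simp [evenPart_eq_self hv]
  · simp [hS0]

end TwoFermionSpace

/-! ### The Jacobi sum for a word with two odd letters. -/

namespace TwoFermionSpace

variable {ι : Type*} {n : ℕ}

/-- The summand of the generalised Jacobi identity that belongs to `I`, without its sign. -/
def jacobiTerm (ν : Fin 2 ↪ ι) (B : ℕ → ℂ) (z : Fin n → TwoFermionSpace ι)
    (I : Finset (Fin n)) : TwoFermionSpace ι :=
  setBracket ν B (fun o : Option (Fin n) => o.elim (setBracket ν B z I) z) Iᶜ.insertNone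

theorem bracket_bracket (ν : Fin 2 ↪ ι) (B : ℕ → ℂ) (z : Fin n → TwoFermionSpace ι)
    (I : Finset (Fin n)) :
    bracket ν B (Iᶜ.card + 1) (Fin.cons (bracket ν B I.card (subword z I)) (subword z Iᶜ)) =
      jacobiTerm ν B z I := by
  rw [bracket_cons_subword, bracket_subword, jacobiTerm]

theorem jacobiTerm_eq_zero (ν : Fin 2 ↪ ι) (B : ℕ → ℂ) {z : Fin n → TwoFermionSpace ι}
    {T I : Finset (Fin n)} (hodd : ∀ i ∈ T, (z i).2 = 0) (heven : ∀ i ∉ T, (z i).1 = 0)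
    (h : (I ∩ T).card ≠ 1 ∨ (Iᶜ ∩ T).card ≠ 1) : jacobiTerm ν B z I = 0 := by
  by_cases h1 : (I ∩ T).card = 1
  · have h2 := h.resolve_left (not_not_intro h1)
    refine setBracket_eq_zero ν B (T := T.map Function.Embedding.some) ?_ ?_ ?_
    · rintro (_ | i) hi
      · simp at hi
      · exact hodd i (by simpa using hi)
    · rintro (_ | i) hi
      · exact setBracket_fst ν B z I
      · exact heven i (by simpa using hi)
    · have h3 : Iᶜ.insertNone ∩ T.map Function.Embedding.some =
          (Iᶜ ∩ T).map Function.Embedding.some := by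
        ext o
        rcases o with _ | i <;> simp
      rwa [h3, Finset.card_map]
  · rw [jacobiTerm, setBracket_eq_zero ν B hodd heven h1, ← bracket_cons_subword]
    exact MultilinearMap.map_coord_zero _ 0 rfl

/-- The case `S' = ∅` is that of a binary outer bracket, whose extra part reproduces the inner
value, scaled by `θSum (z q)`. -/
theorem jacobiTerm_insert (ν : Fin 2 ↪ ι) (B : ℕ → ℂ) {z : Fin n → TwoFermionSpace ι}
    {p q : Fin n} {S S' : Finset (Fin n)} (hp : p ∉ S) (hq : q ∉ S')
    (hc : (insert p S)ᶜ = insert q S') (hS : ∀ j ∈ S, (z j).1 = 0) (hS' : ∀ j ∈ S', (z j).1 = 0) :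
    jacobiTerm ν B z (insert p S) =
      ((B S.card + if S.card = 1 then 1 else 0) * B (S'.card + 1) *
        ((∏ j ∈ S, xSum (z j)) * ∏ j ∈ S', xSum (z j))) • θSum (z p) • θToX ν (z q) +
      if S' = ∅ then (B S.card * ∏ j ∈ S, xSum (z j)) • θSum (z q) • θToX ν (z p) +
        (if S.card = 1 then (θSum (z p) * θSum (z q)) • ∑ j ∈ S, evenPart (z j) else 0) else 0 := by
  rw [jacobiTerm, hc, setBracket_insertNone ν B z (setBracket_fst ν B z _) hq hS',
    xSum_setBracket ν B z hp hS, setBracket_eq_single ν B z hp hS]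
  congr 1
  · rw [smul_smul]
    congr 1
    ring
  · split_ifs <;> module

/-- The contribution of the extra binary bracket as inner bracket. -/
theorem sum_choose_mul_ite (B : ℕ → ℂ) (N : ℕ) :
    ∑ m ∈ Finset.range (N + 1), (N.choose m : ℂ) * ((if m = 1 then 1 else 0) * B (N - m + 1)) =
      N * B N := by
  rcases N with _ | N
  · simp
  · rw [Finset.sum_eq_single 1 (by intro b _ hb; simp [hb]) (by simp)]
    simp

/-- The sum of the terms of the generalised Jacobi identity with one odd letter `z p` in the inner
bracket and another odd letter `z q` in the outer one. -/
theorem sum_jacobiTerm_insert (ν : Fin 2 ↪ ι) (B : ℕ → ℂ) {z : Fin n → TwoFermionSpace ι}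
    {p q : Fin n} (hpq : p ≠ q) {R : Finset (Fin n)} (hR : ∀ j, j ∈ R ↔ j ≠ p ∧ j ≠ q)
    (heven : ∀ j ∈ R, (z j).1 = 0) :
    ∑ S ∈ R.powerset, jacobiTerm ν B z (insert p S) =
      ((∑ m ∈ Finset.range (R.card + 1), (R.card.choose m : ℂ) * (B m * B (R.card - m + 1)) +
        R.card * B R.card) * ∏ j ∈ R, xSum (z j)) • θSum (z p) • θToX ν (z q) +
      ((B R.card * ∏ j ∈ R, xSum (z j)) • θSum (z q) • θToX ν (z p) +
        (if R.card = 1 then (θSum (z p) * θSum (z q)) • ∑ j ∈ R, evenPart (z j) else 0)) := by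
  have hterm : ∀ S ∈ R.powerset, jacobiTerm ν B z (insert p S) =
      ((B S.card + if S.card = 1 then 1 else 0) * B (R.card - S.card + 1)) •
        (∏ j ∈ R, xSum (z j)) • θSum (z p) • θToX ν (z q) +
      if S = R then (B S.card * ∏ j ∈ S, xSum (z j)) • θSum (z q) • θToX ν (z p) +
        (if S.card = 1 then (θSum (z p) * θSum (z q)) • ∑ j ∈ S, evenPart (z j) else 0) else 0 := by
    intro S hS
    rw [Finset.mem_powerset] at hS
    have hp : p ∉ S := fun h => ((hR p).mp (hS h)).1 rfl
    have hq : q ∉ R \ S := fun h => ((hR q).mp (Finset.mem_sdiff.mp h).1).2 rfl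
    have hc : (insert p S)ᶜ = insert q (R \ S) := by
      ext j
      have hj := hR j
      have hj' := @hS j
      simp only [Finset.mem_compl, Finset.mem_insert, Finset.mem_sdiff]
      by_cases h1 : j = p
      · subst h1; simp_all
      · by_cases h2 : j = q
        · subst h2; simp_all
        · simp_all
    have h0 : R \ S = ∅ ↔ S = R := by
      rw [Finset.sdiff_eq_empty_iff_subset]
      exact ⟨fun h => hS.antisymm h, fun h => h ▸ subset_rfl⟩
    rw [jacobiTerm_insert ν B hp hq hc (fun j hj => heven j (hS hj))
      fun j hj => heven j (Finset.mem_sdiff.mp hj).1, Finset.card_sdiff_of_subset hS,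
      mul_comm (∏ j ∈ S, _), Finset.prod_sdiff hS, ← smul_smul]
    simp only [h0]
  rw [Finset.sum_congr rfl hterm, Finset.sum_add_distrib, ← Finset.sum_smul, Finset.sum_ite_eq',
    if_pos (Finset.mem_powerset_self R), Finset.sum_powerset_apply_card
      (fun m => (B m + if m = 1 then 1 else 0) * B (R.card - m + 1)), smul_smul]
  congr 3
  rw [← sum_choose_mul_ite, ← Finset.sum_add_distrib]
  refine Finset.sum_congr rfl fun m _ => ?_
  rw [nsmul_eq_mul]
  ring

/-- Only interchanging the two odd letters can give a sign, and they keep their order when the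
earlier one goes into the inner bracket. -/
theorem koszulSign_insert_left {d : Fin n → ℤ} {p q : Fin n} (hpq : p < q)
    (hd : ∀ j, j ≠ p → j ≠ q → d j = 0) {S : Finset (Fin n)} (hq : q ∉ S) :
    koszulSign d (insert p S) = 1 := by
  refine Finset.prod_eq_one fun a ha => Finset.prod_eq_one fun b hb => ?_
  simp only [Finset.mem_filter, Finset.mem_compl, Finset.mem_insert, not_or] at ha hb
  by_cases hap : a = p
  · subst hap
    rw [hd b hb.1.1 (by rintro rfl; exact lt_asymm hpq hb.2)]
    simp
  · rw [hd a hap (by rintro rfl; exact hq (ha.resolve_left hap))]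
    simp

theorem koszulSign_insert_right {d : Fin n → ℤ} {p q : Fin n} (hpq : p < q) (hp : d p = -1)
    (hq : d q = -1) (hd : ∀ j, j ≠ p → j ≠ q → d j = 0) {S : Finset (Fin n)} (hpS : p ∉ S) :
    koszulSign d (insert q S) = -1 := by
  rw [koszulSign, Finset.prod_eq_single q, Finset.prod_eq_single p]
  · simp [hp, hq]
  · intro b hb hbp
    simp only [Finset.mem_filter, Finset.mem_compl, Finset.mem_insert, not_or] at hb
    rw [hd b hbp hb.1.1]
    simp
  · intro h
    simp [hpq, hpq.ne, hpS] at h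
  · intro a ha haq
    rw [hd a (by rintro rfl; exact hpS (Finset.mem_of_mem_insert_of_ne ha haq)) haq]
    simp
  · simp

/-- The left-hand side of the generalised Jacobi identity for a word with two odd letters. -/
theorem jacobi_sum (ν : Fin 2 ↪ ι) (B : ℕ → ℂ) {d : Fin n → ℤ} {z : Fin n → TwoFermionSpace ι}
    {p q : Fin n} (hpq : p < q) (hp : d p = -1) (hq : d q = -1)
    (hd : ∀ j, j ≠ p → j ≠ q → d j = 0) (hzp : (z p).2 = 0) (hzq : (z q).2 = 0)
    (hz : ∀ j, j ≠ p → j ≠ q → (z j).1 = 0) {R : Finset (Fin n)}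
    (hR : ∀ j, j ∈ R ↔ j ≠ p ∧ j ≠ q) :
    ∑ I : Finset (Fin n), koszulSign d I • bracket ν B (Iᶜ.card + 1)
        (Fin.cons (bracket ν B I.card (subword z I)) (subword z Iᶜ)) =
      ((∑ m ∈ Finset.range (R.card + 1), (R.card.choose m : ℂ) * (B m * B (R.card - m + 1)) -
        (1 - R.card) * B R.card) * ∏ j ∈ R, xSum (z j)) •
        (θSum (z p) • θToX ν (z q) - θSum (z q) • θToX ν (z p)) := by
  have hpR : p ∉ R := fun h => ((hR p).mp h).1 rfl
  have hqR : q ∉ R := fun h => ((hR q).mp h).2 rfl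
  have hpR' : p ∉ insert q R := by simp [hpq.ne, hpR]
  have huniv : (Finset.univ : Finset (Finset (Fin n))) = (insert p (insert q R)).powerset := by
    rw [← Finset.powerset_univ]
    congr 1
    ext j
    simp only [Finset.mem_insert, hR, Finset.mem_univ, true_iff]
    tauto
  have hodd : ∀ i ∈ ({p, q} : Finset (Fin n)), (z i).2 = 0 := by
    simp [hzp, hzq]
  have heven : ∀ i ∉ ({p, q} : Finset (Fin n)), (z i).1 = 0 := by
    intro i hi
    simp only [Finset.mem_insert, Finset.mem_singleton, not_or] at hi
    exact hz i hi.1 hi.2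
  have hR' : ∀ j ∈ R, (z j).1 = 0 := fun j hj => hz j ((hR j).mp hj).1 ((hR j).mp hj).2
  simp only [bracket_bracket]
  rw [huniv, Finset.sum_powerset_insert hpR', Finset.sum_powerset_insert hqR,
    Finset.sum_powerset_insert hqR]
  -- The subsets are sorted by which of `p`, `q` they contain; those with neither or both contribute
  -- nothing.
  have h1 : ∑ S ∈ R.powerset, koszulSign d S • jacobiTerm ν B z S = 0 := by
    refine Finset.sum_eq_zero fun S hS => ?_
    rw [Finset.mem_powerset] at hS
    have : S ∩ {p, q} = ∅ := by
      ext j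
      have := @hS j
      simp only [Finset.mem_inter, Finset.mem_insert, Finset.mem_singleton, Finset.notMem_empty,
        iff_false]
      rintro ⟨h, rfl | rfl⟩ <;> tauto
    rw [jacobiTerm_eq_zero ν B hodd heven (Or.inl (by simp [this])), smul_zero]
  have h2 : ∑ S ∈ R.powerset, koszulSign d (insert p (insert q S)) •
      jacobiTerm ν B z (insert p (insert q S)) = 0 := by
    refine Finset.sum_eq_zero fun S _ => ?_
    have : (insert p (insert q S)) ∩ {p, q} = {p, q} := by
      ext j
      simp only [Finset.mem_inter, Finset.mem_insert, Finset.mem_singleton]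
      tauto
    rw [jacobiTerm_eq_zero ν B hodd heven (Or.inl ?_), smul_zero]
    rw [this, Finset.card_pair hpq.ne]
    decide
  have h3 : ∑ S ∈ R.powerset, koszulSign d (insert p S) • jacobiTerm ν B z (insert p S) =
      ∑ S ∈ R.powerset, jacobiTerm ν B z (insert p S) :=
    Finset.sum_congr rfl fun S hS => by
      rw [koszulSign_insert_left hpq hd fun h => hqR (Finset.mem_powerset.mp hS h), one_smul]
  have h4 : ∑ S ∈ R.powerset, koszulSign d (insert q S) • jacobiTerm ν B z (insert q S) =
      -∑ S ∈ R.powerset, jacobiTerm ν B z (insert q S) := by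
    rw [← Finset.sum_neg_distrib]
    exact Finset.sum_congr rfl fun S hS => by
      rw [koszulSign_insert_right hpq hp hq hd fun h => hpR (Finset.mem_powerset.mp hS h),
        Units.neg_smul, one_smul]
  -- In the difference the `evenPart` terms, symmetric in `p` and `q`, cancel, while the terms with
  -- coefficient `B R.card` turn `R.card * B R.card` into `(R.card - 1) * B R.card`.
  rw [h1, h2, h3, h4, sum_jacobiTerm_insert ν B hpq.ne hR hR',
    sum_jacobiTerm_insert ν B hpq.ne' (fun j => (hR j).trans and_comm) hR',
    mul_comm (θSum (z q)) (θSum (z p))]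
  module

/-! ### The homotopy Lie axioms and the converse. -/

theorem eq_zero_of_mem_grading {d : ℤ} {v : TwoFermionSpace ι} (h1 : d ≠ -1) (h0 : d ≠ 0)
    (hv : v ∈ grading ι d) : v = 0 := by
  rwa [grading, if_neg h1, if_neg h0, Submodule.mem_bot] at hv

variable {d : Fin n → ℤ} {z : Fin n → TwoFermionSpace ι}

theorem bracket_mem_grading (ν : Fin 2 ↪ ι) (B : ℕ → ℂ) (hz : ∀ i, z i ∈ grading ι (d i)) :
    bracket ν B n z ∈ grading ι (1 + ∑ i, d i) := by
  by_cases h : ∃ i, d i ≠ -1 ∧ d i ≠ 0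
  · obtain ⟨i, h1, h0⟩ := h
    rw [MultilinearMap.map_coord_zero _ i (eq_zero_of_mem_grading h1 h0 (hz i))]
    exact Submodule.zero_mem _
  push Not at h
  rw [bracket_apply]
  set T : Finset (Fin n) := {i | d i = -1} with hT
  by_cases hc : T.card = 1
  · have hsum : 1 + ∑ i, d i = 0 := by
      have h2 : ∀ i, d i = if d i = -1 then -1 else 0 := fun i => by
        split_ifs with hi
        · exact hi
        · exact h i hi
      rw [Finset.sum_congr rfl fun i _ => h2 i, ← Finset.sum_filter, ← hT, Finset.sum_const, hc]
      rfl
    rw [hsum]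
    have h3 := mem_grading_zero (setBracket ν B z Finset.univ).2
    rwa [← setBracket_fst ν B z Finset.univ] at h3
  · rw [setBracket_eq_zero ν B (T := T)]
    · exact Submodule.zero_mem _
    · intro i hi
      have hi : d i = -1 := by simpa [hT] using hi
      exact snd_eq_zero_of_mem (hi ▸ hz i)
    · intro i hi
      exact fst_eq_zero_of_mem (by simpa [hT] using hi) (hz i)
    · rwa [Finset.univ_inter]

/-- The brackets are symmetric without signs; when both exchanged letters are odd, where a sign is
due, they vanish. -/
theorem bracket_swap (ν : Fin 2 ↪ ι) (B : ℕ → ℂ) (hz : ∀ i, z i ∈ grading ι (d i))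
    {i j : Fin n} (hij : i ≠ j) :
    bracket ν B n z = Int.negOnePow (d i * d j) • bracket ν B n (z ∘ Equiv.swap i j) := by
  have hcomp : bracket ν B n (z ∘ Equiv.swap i j) = bracket ν B n z := by
    have h := bracket_comp ν B z (Equiv.swap i j).toEmbedding
    rw [Finset.map_univ_equiv, ← bracket_apply] at h
    exact h
  rw [hcomp]
  by_cases h : ∃ i, d i ≠ -1 ∧ d i ≠ 0
  · obtain ⟨i, h1, h0⟩ := h
    rw [MultilinearMap.map_coord_zero _ i (eq_zero_of_mem_grading h1 h0 (hz i)), smul_zero]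
  push Not at h
  by_cases hi : d i = -1
  · by_cases hj : d j = -1
    · rw [bracket_apply, setBracket_eq_zero ν B (T := ({k | d k = -1} : Finset (Fin n))), smul_zero]
      · intro k hk
        have hk : d k = -1 := by simpa using hk
        exact snd_eq_zero_of_mem (hk ▸ hz k)
      · intro k hk
        exact fst_eq_zero_of_mem (by simpa using hk) (hz k)
      · rw [Finset.univ_inter]
        exact (Finset.one_lt_card.mpr ⟨i, by simpa using hi, j, by simpa using hj, hij⟩).ne'
    · simp [h j hj]
  · simp [h i hi]

theorem bracket_jacobi (ν : Fin 2 ↪ ι) (B : ℕ → ℂ)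
    (hB : ∀ n : ℕ, ∑ k ∈ Finset.range (n + 1), (n.choose k : ℂ) * (B k * B (n - k + 1)) =
      (1 - n) * B n) (hz : ∀ i, z i ∈ grading ι (d i)) :
    ∑ I : Finset (Fin n), koszulSign d I • bracket ν B (Iᶜ.card + 1)
      (Fin.cons (bracket ν B I.card (subword z I)) (subword z Iᶜ)) = 0 := by
  by_cases h : ∃ i, d i ≠ -1 ∧ d i ≠ 0
  · obtain ⟨i, h1, h0⟩ := h
    have hi := eq_zero_of_mem_grading h1 h0 (hz i)
    have hsub : ∀ I : Finset (Fin n), i ∈ I → ∃ k, subword z I k = 0 := fun I hI => by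
      rw [← Finset.mem_coe, ← Finset.range_orderEmbOfFin I rfl] at hI
      obtain ⟨k, hk⟩ := hI
      exact ⟨k, by rw [subword, hk, hi]⟩
    refine Finset.sum_eq_zero fun I _ => ?_
    by_cases hI : i ∈ I
    · obtain ⟨k, hk⟩ := hsub I hI
      rw [MultilinearMap.map_coord_zero (bracket ν B I.card) k hk,
        MultilinearMap.map_coord_zero _ 0 rfl, smul_zero]
    · obtain ⟨k, hk⟩ := hsub Iᶜ (Finset.mem_compl.mpr hI)
      rw [MultilinearMap.map_coord_zero _ k.succ (by rw [Fin.cons_succ, hk]), smul_zero]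
  push Not at h
  set T : Finset (Fin n) := {i | d i = -1} with hT
  have hodd : ∀ i ∈ T, (z i).2 = 0 := fun i hi => by
    have hi : d i = -1 := by simpa [hT] using hi
    exact snd_eq_zero_of_mem (hi ▸ hz i)
  have heven : ∀ i ∉ T, (z i).1 = 0 := fun i hi =>
    fst_eq_zero_of_mem (by simpa [hT] using hi) (hz i)
  by_cases hc : T.card = 2
  · obtain ⟨p, q, hpq, hTpq⟩ : ∃ p q, p < q ∧ T = {p, q} := by
      obtain ⟨p, q, hpq, hTpq⟩ := Finset.card_eq_two.mp hc
      rcases lt_or_gt_of_ne hpq with hlt | hlt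
      · exact ⟨p, q, hlt, hTpq⟩
      · exact ⟨q, p, hlt, hTpq.trans (Finset.pair_comm p q)⟩
    have hmem : ∀ j, d j = -1 ↔ j = p ∨ j = q := fun j => by
      have : j ∈ T ↔ j ∈ ({p, q} : Finset (Fin n)) := by rw [hTpq]
      simpa [hT] using this
    rw [jacobi_sum ν B hpq ((hmem p).mpr (Or.inl rfl)) ((hmem q).mpr (Or.inr rfl))
      (R := (Finset.univ.erase p).erase q), hB, sub_self, zero_mul, zero_smul]
    · exact fun j h1 h2 => h j fun h3 => ((hmem j).mp h3).elim h1 h2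
    · exact hodd p (by simp [hTpq])
    · exact hodd q (by simp [hTpq])
    · exact fun j h1 h2 => heven j (by simp [hTpq, h1, h2])
    · intro j
      simp [and_comm]
  · refine Finset.sum_eq_zero fun I _ => ?_
    rw [bracket_bracket, jacobiTerm_eq_zero ν B hodd heven, smul_zero]
    -- One odd letter in `I` and one in its complement would make two in all.
    by_contra! hI
    refine hc ?_
    rw [← Finset.card_inter_add_card_sdiff T I, Finset.inter_comm T, hI.1,
      Finset.sdiff_eq_inter_compl, Finset.inter_comm T, hI.2]

theorem recursion_of_jacobi (ν : Fin 2 ↪ ι) (B : ℕ → ℂ)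
    (h : IsHomotopyLie (grading ι) (bracket ν B)) (n : ℕ) :
    ∑ k ∈ Finset.range (n + 1), (n.choose k : ℂ) * (B k * B (n - k + 1)) = (1 - n) * B n := by
  -- Any even generators would do for the remaining letters, since only their `xSum`, equal to `1`,
  -- enters.
  let z : Fin (n + 2) → TwoFermionSpace ι := Fin.cons (θ 0) (Fin.cons (θ 1) fun _ => x (ν 0))
  let d : Fin (n + 2) → ℤ := Fin.cons (-1) (Fin.cons (-1) fun _ => 0)
  have hz : ∀ i, z i ∈ grading ι (d i) := by
    refine Fin.cases (mem_grading_neg_one _) (Fin.cases (mem_grading_neg_one _) fun _ => ?_)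
    exact mem_grading_zero _
  have hsucc : ∀ j : Fin (n + 2), j ≠ 0 → j ≠ 1 → ∃ k : Fin n, j = k.succ.succ := by
    refine Fin.cases (by simp) (Fin.cases (by simp) fun k _ _ => ⟨k, rfl⟩)
  have hJ := h.jacobi (n + 2) d z hz
  rw [jacobi_sum ν B (p := 0) (q := 1) (R := (Finset.univ.erase 0).erase 1) (by simp) rfl rfl
    ?_ rfl rfl ?_ (by intro j; simp [and_comm])] at hJ
  · have hcard : ((Finset.univ.erase (0 : Fin (n + 2))).erase 1).card = n := by
      rw [Finset.card_erase_of_mem (by simp), Finset.card_erase_of_mem (by simp)]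
      simp
    have hprod : ∏ j ∈ (Finset.univ.erase (0 : Fin (n + 2))).erase 1, xSum (z j) = 1 := by
      refine Finset.prod_eq_one fun j hj => ?_
      simp only [Finset.mem_erase, Finset.mem_univ, and_true] at hj
      obtain ⟨k, rfl⟩ := hsucc j hj.2 hj.1
      simp [z, xSum, x]
    -- This vector is `x (ν 1) - x (ν 0)`, nonzero because `ν` is injective; two different odd
    -- generators are needed here.
    have hne : θSum (z 0) • θToX ν (z 1) - θSum (z 1) • θToX ν (z 0) ≠ 0 := by
      have h0 : z 0 = θ 0 := rfl
      have h1 : z 1 = θ 1 := rfl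
      intro he
      have he' := congrArg (fun v : TwoFermionSpace ι => v.2 (ν 1)) he
      simp [h0, h1, θSum, θToX, θCoeff, θ, x] at he'
    rw [hcard, hprod, mul_one] at hJ
    exact sub_eq_zero.mp ((smul_eq_zero.mp hJ).resolve_right hne)
  · intro j h0 h1
    obtain ⟨k, rfl⟩ := hsucc j h0 h1
    rfl
  · intro j h0 h1
    obtain ⟨k, rfl⟩ := hsucc j h0 h1
    rfl

end TwoFermionSpace
end

theorem proposition1 {ι : Type*} (ν : Fin 2 ↪ ι) (B : ℕ → ℂ) (hB : B 0 = 1) :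
    IsHomotopyLie (TwoFermionSpace.grading ι) (TwoFermionSpace.bracket ν B) ↔
      ∀ M : ℕ, B M = (1 - (M : ℂ)) ^ ((M : ℤ) - 1) := by
  rw [← recursion_iff B hB]
  refine ⟨TwoFermionSpace.recursion_of_jacobi ν B, fun h => ⟨fun n d z hz => ?_,
    fun n d z hz i j hij => ?_, fun n d z hz => ?_⟩⟩
  · exact TwoFermionSpace.bracket_mem_grading ν B hz
  · exact TwoFermionSpace.bracket_swap ν B hz (by rintro rfl; omega)
  · exact TwoFermionSpace.bracket_jacobi ν B h hz
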